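/- Let $X$ be a complex surface and let $w\in H^0(X,S^2\Omega^1_X)$ be a holomorphic symmetric 2-differential of rank 2, i.e. at the general point $x\in X$ (on a dense open subset) $w(x)$ is a product of two linearly independent linear forms on $T_xX$. Say that $w$ has a holomorphic closed decomposition at $x$ if $w=\mu_1\mu_2$ on some open neighbourhood of $x$, with $\mu_1,\mu_2$ closed holomorphic 1-forms there; that $w$ is closed if it has a holomorphic closed decomposition at the general point of $X$; and that $w$ is of the 1st kind on an open set $U\subseteq X$ if it has a holomorphic closed decomposition at every point of $U$. Let $B_w=\{x\in X \mid w \text{ has no holomorphic closed decomposition at } x\}$ be the breakdown locus. (1) If $w$ is closed, then $B_w$ has no isolated points. (2) Let $\mathbb B\subseteq X$ be a coordinate ball, i.e. the preimage under a holomorphic chart of an open ball in $\mathbb C^2$ contained in the image of the chart, and let $\mathbb B^*$ be $\mathbb B$ without its centre. If $w$ is of the 1st kind on $\mathbb B^*$, then $w$ is of the 1st kind on $\mathbb B$. -/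

import Mathlib

open scoped Manifold ContDiff Topology

noncomputable section

/-- The model space `ℂ²`, with its Hermitian norm. -/
abbrev C2 : Type := EuclideanSpace ℂ (Fin 2)

/-- The holomorphic charts of a complex surface `X`, i.e. the charts of its maximal holomorphic
atlas (over `ℂ`, class `C^ω` means holomorphic). -/
abbrev holomorphicCharts (X : Type*) [TopologicalSpace X] [ChartedSpace C2 X] :
    Set (OpenPartialHomeomorph X C2) :=
  IsManifold.maximalAtlas 𝓘(ℂ, C2) ω X

/-- A (not necessarily regular) field of `ℂ`-linear forms on the holomorphic tangent spaces. -/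
abbrev OneFormField (X : Type*) [TopologicalSpace X] [ChartedSpace C2 X] : Type _ :=
  ∀ x : X, TangentSpace 𝓘(ℂ, C2) x →L[ℂ] ℂ

/-- The expression of a field of linear forms in a chart `e`: its pullback under `e.symm`. -/
def OneFormField.inChart {X : Type*} [TopologicalSpace X] [ChartedSpace C2 X]
    (μ : OneFormField X) (e : OpenPartialHomeomorph X C2) (y : C2) : C2 →L[ℂ] ℂ :=
  (μ (e.symm y)).comp (mfderiv 𝓘(ℂ, C2) 𝓘(ℂ, C2) e.symm y)

/-- `μ` is a closed holomorphic 1-form on `U` (used for open `U`): in every holomorphic chart its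
expression `α` is holomorphic, and `dα(u, v) = (D_u α)(v) - (D_v α)(u)` vanishes. -/
structure OneFormField.IsClosedHolomorphicOn {X : Type*} [TopologicalSpace X] [ChartedSpace C2 X]
    (μ : OneFormField X) (U : Set X) : Prop where
  holomorphic : ∀ e ∈ holomorphicCharts X,
    DifferentiableOn ℂ (μ.inChart e) (e.target ∩ e.symm ⁻¹' U)
  closed : ∀ e ∈ holomorphicCharts X, ∀ y ∈ e.target ∩ e.symm ⁻¹' U, ∀ u v : C2,
    fderiv ℂ (μ.inChart e) y u v = fderiv ℂ (μ.inChart e) y v u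

/-- A holomorphic symmetric 2-differential `w ∈ H⁰(X, S²Ω¹_X)`: a field of quadratic forms on the
holomorphic tangent spaces (homogeneous polynomials of degree 2) which in every holomorphic chart
reads `a(z) dz₁² + b(z) dz₁ dz₂ + c(z) dz₂²` with holomorphic coefficients, i.e. whose value on each
constant vector `v` is a holomorphic function of `z`. -/
structure SymmetricTwoDifferential (X : Type*) [TopologicalSpace X] [ChartedSpace C2 X] where
  form : ∀ x : X, QuadraticForm ℂ (TangentSpace 𝓘(ℂ, C2) x)
  holomorphic : ∀ e ∈ holomorphicCharts X, ∀ v : C2,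
    DifferentiableOn ℂ
      (fun y : C2 => form (e.symm y) (mfderiv 𝓘(ℂ, C2) 𝓘(ℂ, C2) e.symm y v)) e.target

namespace SymmetricTwoDifferential

/-- A property holds at the general point of `X` if it holds on a dense open subset. -/
def AtGeneralPoint {X : Type*} [TopologicalSpace X] (P : X → Prop) : Prop :=
  ∃ U : Set X, IsOpen U ∧ Dense U ∧ ∀ x ∈ U, P x

variable {X : Type*} [TopologicalSpace X] [ChartedSpace C2 X]

/-- `w(x)` is a product of two linearly independent linear forms on `T_x X`, that is, its zero
locus consists of two distinct lines. -/
def DefinesTwoLinesAt (w : SymmetricTwoDifferential X) (x : X) : Prop :=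
  ∃ α β : TangentSpace 𝓘(ℂ, C2) x →ₗ[ℂ] ℂ,
    LinearIndependent ℂ ![α, β] ∧ w.form x = QuadraticMap.linMulLin α β

/-- `w` has rank 2: at the general point it defines two distinct lines. -/
def HasRankTwo (w : SymmetricTwoDifferential X) : Prop :=
  AtGeneralPoint w.DefinesTwoLinesAt

/-- `w = μ₁ μ₂` on `U`, with `μ₁`, `μ₂` closed holomorphic 1-forms on `U`. -/
def HasHolomorphicClosedDecompositionOn (w : SymmetricTwoDifferential X) (U : Set X) : Prop :=
  ∃ μ₁ μ₂ : OneFormField X, μ₁.IsClosedHolomorphicOn U ∧ μ₂.IsClosedHolomorphicOn U ∧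
    ∀ x ∈ U, w.form x = QuadraticMap.linMulLin (μ₁ x).toLinearMap (μ₂ x).toLinearMap

/-- `w` has a holomorphic closed decomposition at `x`, i.e. on some open neighbourhood of `x`. -/
def HasHolomorphicClosedDecompositionAt (w : SymmetricTwoDifferential X) (x : X) : Prop :=
  ∃ U : Set X, IsOpen U ∧ x ∈ U ∧ w.HasHolomorphicClosedDecompositionOn U

/-- `w` is closed: it has a holomorphic closed decomposition at the general point. -/
def Closed (w : SymmetricTwoDifferential X) : Prop :=
  AtGeneralPoint w.HasHolomorphicClosedDecompositionAt

/-- `w` is of the 1st kind on `U` (used for open `U`): it has a holomorphic closed decomposition at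
every point of `U`. -/
def IsOfFirstKindOn (w : SymmetricTwoDifferential X) (U : Set X) : Prop :=
  ∀ x ∈ U, w.HasHolomorphicClosedDecompositionAt x

/-- The breakdown locus `B_w`. -/
def breakdownLocus (w : SymmetricTwoDifferential X) : Set X :=
  {x | ¬ w.HasHolomorphicClosedDecompositionAt x}

end SymmetricTwoDifferential

end

/-!
Where `w` defines two distinct lines, a closed decomposition `w = μ₁ μ₂` is unique up to swapping
the factors and rescaling them by `t⁻¹` and `t`; since all the forms are closed, `t` is locally
constant. Hence local closed decompositions can be continued along segments, and on a star-shaped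
open set they glue to a single one. This applies to a ball slit along half of a complex line
through its centre. The two factors extend holomorphically across the centre by Cauchy's integral
formula on discs transverse to that line, as in Hartogs' theorem, and by the identity theorem the
extensions are still closed with product `w`. At an isolated point of the breakdown locus, `w`
would be of the 1st kind on a punctured coordinate ball, hence at the point itself.
-/

section LinearForms

variable {K V : Type*} [Field K] [AddCommGroup V] [Module K V]

theorem eq_zero_or_eq_zero_of_linMulLin_eq_zero {f g : V →ₗ[K] K}
    (h : QuadraticMap.linMulLin f g = 0) : f = 0 ∨ g = 0 := by
  have hmul (v : V) : f v = 0 ∨ g v = 0 := mul_eq_zero.1 (DFunLike.congr_fun h v)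
  by_contra! hne
  obtain ⟨u, hu⟩ := DFunLike.ne_iff.1 hne.1
  obtain ⟨v, hv⟩ := DFunLike.ne_iff.1 hne.2
  have hgu : g u = 0 := (hmul u).resolve_left hu
  have hfv : f v = 0 := (hmul v).resolve_right hv
  rcases hmul (u + v) with h | h
  · exact hu (by simpa [hfv] using h)
  · exact hv (by simpa [hgu] using h)

theorem exists_eq_smul_of_ker_le_ker {f g : V →ₗ[K] K}
    (h : LinearMap.ker f ≤ LinearMap.ker g) : ∃ t : K, g = t • f := by
  have hspan : g ∈ Submodule.span K (Set.range fun _ : Unit => f) :=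
    mem_span_of_iInf_ker_le_ker (by simpa using h)
  rw [Set.range_const, Submodule.mem_span_singleton] at hspan
  exact hspan.imp fun _ => Eq.symm

theorem eq_smul_of_linMulLin_smul_eq {f g f' : V →ₗ[K] K} {t : K} (hg : g ≠ 0)
    (h : QuadraticMap.linMulLin f' (t • g) = QuadraticMap.linMulLin f g) : t • f' = f := by
  have hsub : QuadraticMap.linMulLin (t • f' - f) g = 0 := by
    ext v
    have hv := DFunLike.congr_fun h v
    simp only [QuadraticMap.linMulLin_apply, LinearMap.smul_apply, LinearMap.sub_apply,
      smul_eq_mul, zero_apply] at hv ⊢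
    linear_combination hv
  exact sub_eq_zero.1 ((eq_zero_or_eq_zero_of_linMulLin_eq_zero hsub).resolve_right hg)

theorem linMulLin_comm (f g : V →ₗ[K] K) :
    QuadraticMap.linMulLin f g = QuadraticMap.linMulLin g f :=
  QuadraticMap.ext fun v => mul_comm (f v) (g v)

theorem exists_smul_of_linMulLin_eq {f g f' g' : V →ₗ[K] K} (hf : f ≠ 0) (hg : g ≠ 0)
    (h : QuadraticMap.linMulLin f' g' = QuadraticMap.linMulLin f g) :
    ∃ t : K, t ≠ 0 ∧ ((f' = t⁻¹ • f ∧ g' = t • g) ∨ (g' = t⁻¹ • f ∧ f' = t • g)) := by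
  -- One of the factors `f'`, `g'` vanishes on the hyperplane `g = 0`.
  have hker : QuadraticMap.linMulLin (f' ∘ₗ (LinearMap.ker g).subtype)
      (g' ∘ₗ (LinearMap.ker g).subtype) = 0 := by
    rw [← QuadraticMap.linMulLin_comp, h]
    ext v
    simp
  wlog hg' : g' ∘ₗ (LinearMap.ker g).subtype = 0 generalizing f' g'
  · obtain ⟨t, ht, hor⟩ := this (f' := g') (g' := f') ((linMulLin_comm _ _).trans h)
      ((linMulLin_comm _ _).trans hker)
      ((eq_zero_or_eq_zero_of_linMulLin_eq_zero hker).resolve_right hg')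
    exact ⟨t, ht, hor.symm⟩
  obtain ⟨t, rfl⟩ := exists_eq_smul_of_ker_le_ker (LinearMap.le_ker_iff_comp_subtype_eq_zero.2 hg')
  have htf : t • f' = f := eq_smul_of_linMulLin_smul_eq hg h
  have ht : t ≠ 0 := by
    rintro rfl
    exact hf (by rw [← htf, zero_smul])
  exact ⟨t, ht, Or.inl ⟨(eq_inv_smul_iff₀ ht).2 htf, rfl⟩⟩

/-- `q` is a product of two linearly independent linear forms, that is, its zero locus consists of
two distinct hyperplanes. This is `SymmetricTwoDifferential.DefinesTwoLinesAt` for a quadratic form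
on an arbitrary vector space. -/
def DefinesTwoHyperplanes (q : QuadraticForm K V) : Prop :=
  ∃ f g : V →ₗ[K] K, LinearIndependent K ![f, g] ∧ q = QuadraticMap.linMulLin f g

theorem DefinesTwoHyperplanes.linearIndependent {f g : V →ₗ[K] K}
    (h : DefinesTwoHyperplanes (QuadraticMap.linMulLin f g)) : LinearIndependent K ![f, g] := by
  obtain ⟨a, b, hab, heq⟩ := h
  obtain ⟨t, ht, ⟨rfl, rfl⟩ | ⟨rfl, rfl⟩⟩ := exists_smul_of_linMulLin_eq
    (hab.ne_zero 0) (hab.ne_zero 1) heq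
  · exact (LinearIndependent.pair_smul_smul_iff (inv_ne_zero ht).isUnit ht.isUnit).2 hab
  · exact LinearIndependent.pair_symm_iff.1
      ((LinearIndependent.pair_smul_smul_iff (inv_ne_zero ht).isUnit ht.isUnit).2 hab)

theorem DefinesTwoHyperplanes.comp {V' : Type*} [AddCommGroup V'] [Module K V']
    {q : QuadraticForm K V} (hq : DefinesTwoHyperplanes q) {h : V' →ₗ[K] V}
    (hh : Function.Surjective h) : DefinesTwoHyperplanes (q.comp h) := by
  obtain ⟨f, g, hfg, rfl⟩ := hq
  refine ⟨f ∘ₗ h, g ∘ₗ h, ?_, QuadraticMap.linMulLin_comp f g h⟩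
  refine LinearIndependent.pair_iff.2 fun s t hst => LinearIndependent.pair_iff.1 hfg s t ?_
  rwa [← LinearMap.cancel_right hh, LinearMap.add_comp, LinearMap.smul_comp, LinearMap.smul_comp,
    LinearMap.zero_comp]

theorem eq_zero_of_mul_apply_comm {f g δ : V →ₗ[K] K} (hfg : LinearIndependent K ![f, g])
    (hf : ∀ u v, δ u * f v = δ v * f u) (hg : ∀ u v, δ u * g v = δ v * g u) : δ = 0 := by
  by_contra hδ
  obtain ⟨u, hu⟩ := DFunLike.ne_iff.1 hδ
  have hmultiple {a : V →ₗ[K] K} (ha : ∀ u v, δ u * a v = δ v * a u) : ∃ t : K, a = t • δ := by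
    refine exists_eq_smul_of_ker_le_ker fun v (hv : δ v = 0) => ?_
    exact (mul_eq_zero.1 ((ha u v).trans (by rw [hv, zero_mul]))).resolve_left hu
  obtain ⟨s, rfl⟩ := hmultiple hf
  obtain ⟨t, rfl⟩ := hmultiple hg
  have hst := LinearIndependent.pair_iff.1 hfg t (-s)
    (by rw [smul_smul, smul_smul, ← add_smul, neg_mul, mul_comm, add_neg_cancel, zero_smul])
  exact hfg.ne_zero 1 (by simp [hst.1])

end LinearForms

section SeveralVariables

open Metric Set

variable {E F : Type*} [NormedAddCommGroup E] [NormedSpace ℂ E] [NormedAddCommGroup F]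
  [NormedSpace ℂ F] {U : Set E}

theorem norm_fderiv_le_of_norm_le_on_ball {f : E → F} {c : E} {R M : ℝ} (hR : 0 < R)
    (hd : DifferentiableOn ℂ f (ball c R)) (hM : ∀ z ∈ ball c R, ‖f z‖ ≤ M) :
    ‖fderiv ℂ f c‖ ≤ 2 * M / R := by
  refine Complex.norm_fderiv_le_div_of_mapsTo_ball hd (fun z hz => ?_) hR
  rw [mem_closedBall_iff_norm]
  linarith [norm_sub_le (f z) (f c), hM z hz, hM c (mem_ball_self hR)]

theorem continuousOn_fderiv_of_param [ProperSpace E] {Θ : Type*} [TopologicalSpace Θ] {K : Set Θ}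
    {H : Θ → E → F} (hU : IsOpen U) (hc : ContinuousOn (Function.uncurry H) (K ×ˢ U))
    (hd : ∀ θ ∈ K, DifferentiableOn ℂ (H θ) U) {z : E} (hz : z ∈ U) :
    ContinuousOn (fun θ => fderiv ℂ (H θ) z) K := by
  obtain ⟨δ, hδ, hδU⟩ := nhds_basis_closedBall.mem_iff.1 (hU.mem_nhds hz)
  refine fun θ₀ hθ₀ => Metric.continuousWithinAt_iff'.2 fun ε hε => ?_
  obtain ⟨v, hv, hclose⟩ := (isCompact_closedBall z δ).mem_uniformity_of_prod
    (hc.mono (prod_mono_right hδU)) hθ₀ (dist_mem_uniformity (show 0 < ε * δ / 4 by positivity))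
  filter_upwards [hv, self_mem_nhdsWithin] with θ hθv hθ
  have hsub : ball z δ ⊆ U := ball_subset_closedBall.trans hδU
  have hbound (x : E) (hx : x ∈ ball z δ) : ‖(H θ - H θ₀) x‖ ≤ ε * δ / 4 := by
    have h : dist (H θ x) (H θ₀ x) < ε * δ / 4 := hclose θ hθv x (ball_subset_closedBall hx)
    simpa only [dist_eq_norm, Pi.sub_apply] using h.le
  rw [dist_eq_norm, ← fderiv_sub ((hd θ hθ).differentiableAt (hU.mem_nhds hz))
    ((hd θ₀ hθ₀).differentiableAt (hU.mem_nhds hz))]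
  calc ‖fderiv ℂ (H θ - H θ₀) z‖ ≤ 2 * (ε * δ / 4) / δ :=
        norm_fderiv_le_of_norm_le_on_ball hδ
          (((hd θ hθ).mono hsub).sub ((hd θ₀ hθ₀).mono hsub)) hbound
    _ = ε / 2 := by field_simp; norm_num
    _ < ε := half_lt_self hε

theorem differentiableOn_intervalIntegral_of_param [FiniteDimensional ℂ E] [CompleteSpace F]
    {H : ℝ → E → F} {a b : ℝ} (hU : IsOpen U)
    (hc : ContinuousOn (Function.uncurry H) (uIcc a b ×ˢ U))
    (hd : ∀ θ ∈ uIcc a b, DifferentiableOn ℂ (H θ) U) :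
    DifferentiableOn ℂ (fun z => ∫ θ in a..b, H θ z) U := by
  have : ProperSpace E := FiniteDimensional.proper ℂ E
  intro z₀ hz₀
  obtain ⟨δ, hδ, hδU⟩ := nhds_basis_closedBall.mem_iff.1 (hU.mem_nhds hz₀)
  obtain ⟨M, hM⟩ := (isCompact_uIcc.prod (isCompact_closedBall z₀ δ)).exists_bound_of_continuousOn
    (hc.mono (prod_mono_right hδU))
  have hHz (z : E) (hz : z ∈ U) : ContinuousOn (fun θ => H θ z) (uIcc a b) :=
    hc.comp (f := fun θ => (θ, z)) (by fun_prop) fun θ hθ => ⟨hθ, hz⟩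
  have hHmeas (z : E) (hz : z ∈ U) : MeasureTheory.AEStronglyMeasurable (fun θ => H θ z)
      (MeasureTheory.volume.restrict (uIoc a b)) :=
    ((hHz z hz).mono uIoc_subset_uIcc).aestronglyMeasurable measurableSet_uIoc
  have hbound (θ : ℝ) (hθ : θ ∈ uIoc a b) (z : E) (hz : z ∈ ball z₀ (δ / 2)) :
      ‖fderiv ℂ (H θ) z‖ ≤ 2 * M / (δ / 2) := by
    have hsub : ball z (δ / 2) ⊆ closedBall z₀ δ :=
      (ball_subset_ball' (by linarith [mem_ball.1 hz])).trans ball_subset_closedBall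
    exact norm_fderiv_le_of_norm_le_on_ball (by positivity)
      ((hd θ (uIoc_subset_uIcc hθ)).mono (hsub.trans hδU))
      fun x hx => hM (θ, x) ⟨uIoc_subset_uIcc hθ, hsub hx⟩
  have hderiv (θ : ℝ) (hθ : θ ∈ uIoc a b) (z : E) (hz : z ∈ ball z₀ (δ / 2)) :
      HasFDerivAt (H θ) (fderiv ℂ (H θ) z) z :=
    ((hd θ (uIoc_subset_uIcc hθ)).differentiableAt (hU.mem_nhds
      (hδU (ball_subset_closedBall (ball_subset_ball (by linarith) hz))))).hasFDerivAt
  have key := intervalIntegral.hasFDerivAt_integral_of_dominated_of_fderiv_le (𝕜 := ℂ)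
    (μ := MeasureTheory.volume) (F := fun z θ => H θ z) (F' := fun z θ => fderiv ℂ (H θ) z)
    (bound := fun _ => 2 * M / (δ / 2)) (ball_mem_nhds z₀ (half_pos hδ))
    (by filter_upwards [hU.mem_nhds hz₀] with z hz using hHmeas z hz)
    (hHz z₀ hz₀).intervalIntegrable
    (((continuousOn_fderiv_of_param hU hc hd hz₀).mono
      uIoc_subset_uIcc).aestronglyMeasurable measurableSet_uIoc)
    (Filter.Eventually.of_forall hbound) intervalIntegrable_const
    (Filter.Eventually.of_forall hderiv)
  exact key.differentiableAt.differentiableWithinAt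

theorem differentiableOn_circleIntegral_of_param [FiniteDimensional ℂ E] [CompleteSpace F]
    {G : ℂ → E → F} (hU : IsOpen U) {c : ℂ} {R : ℝ} (hR : 0 ≤ R)
    (hc : ContinuousOn (Function.uncurry G) (sphere c R ×ˢ U))
    (hd : ∀ ζ ∈ sphere c R, DifferentiableOn ℂ (G ζ) U) :
    DifferentiableOn ℂ (fun z => ∮ ζ in C(c, R), G ζ z) U := by
  refine differentiableOn_intervalIntegral_of_param
    (H := fun θ z => deriv (circleMap c R) θ • G (circleMap c R θ) z) hU ?_ fun θ _ =>
      (hd _ (circleMap_mem_sphere c hR θ)).const_smul _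
  have hderiv : Continuous fun p : ℝ × E => deriv (circleMap c R) p.1 := by
    simp only [deriv_circleMap]
    fun_prop
  exact hderiv.continuousOn.smul (hc.comp (f := fun p : ℝ × E => (circleMap c R p.1, p.2))
    (by fun_prop) fun p hp => ⟨circleMap_mem_sphere c hR p.1, hp.2⟩)

theorem fderiv_apply_eq_circleIntegral [CompleteSpace F] {f : E → F} {z u : E} {r : ℝ}
    (hr : 0 < r) (hf : ∀ t ∈ closedBall (0 : ℂ) r, DifferentiableAt ℂ f (z + t • u)) :
    fderiv ℂ f z u =
      (2 * Real.pi * Complex.I : ℂ)⁻¹ • ∮ ζ in C(0, r), (1 / (ζ - 0) ^ 2) • f (z + ζ • u) := by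
  have hline (t : ℂ) (ht : t ∈ closedBall 0 r) :
      HasDerivAt (fun t : ℂ => f (z + t • u)) (fderiv ℂ f (z + t • u) u) t :=
    (hf t ht).hasFDerivAt.comp_hasDerivAt t
      (by simpa using ((hasDerivAt_id t).smul_const u).const_add z)
  have hdiff : DifferentiableOn ℂ (fun t : ℂ => f (z + t • u)) (closedBall 0 r) :=
    fun t ht => (hline t ht).differentiableAt.differentiableWithinAt
  rw [hdiff.deriv_eq_smul_circleIntegral hr, (hline 0 (mem_closedBall_self hr.le)).deriv,
    inv_smul_smul₀ Complex.two_pi_I_ne_zero, zero_smul, add_zero]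

theorem differentiableOn_fderiv_apply [FiniteDimensional ℂ E] [CompleteSpace F] {f : E → F}
    (hU : IsOpen U) (hf : DifferentiableOn ℂ f U) (u : E) :
    DifferentiableOn ℂ (fun z => fderiv ℂ f z u) U := by
  intro z₀ hz₀
  have hshift : {p : E × ℂ | p.1 + p.2 • u ∈ U} ∈ 𝓝 (z₀, (0 : ℂ)) :=
    (hU.preimage (by fun_prop)).mem_nhds (by simpa using hz₀)
  rw [(nhds_basis_ball.prod_nhds nhds_basis_closedBall).mem_iff] at hshift
  obtain ⟨⟨ρ, r⟩, ⟨hρ, hr⟩, hsub⟩ := hshift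
  have hmem {z : E} {ζ : ℂ} (hz : z ∈ ball z₀ ρ) (hζ : ζ ∈ closedBall 0 r) : z + ζ • u ∈ U :=
    hsub (mk_mem_prod hz hζ)
  have hint : DifferentiableOn ℂ (fun z => (2 * Real.pi * Complex.I : ℂ)⁻¹ •
      ∮ ζ in C(0, r), (1 / (ζ - 0) ^ 2) • f (z + ζ • u)) (ball z₀ ρ) := by
    refine (differentiableOn_circleIntegral_of_param
      (G := fun ζ z => (1 / (ζ - 0) ^ 2) • f (z + ζ • u)) isOpen_ball hr.le (.smul ?_ ?_)
      fun ζ hζ => ?_).const_smul _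
    · refine .div (by fun_prop) (by fun_prop) fun p hp => ?_
      exact pow_ne_zero 2 (sub_ne_zero.2 (ne_of_mem_sphere hp.1 hr.ne'))
    · exact hf.continuousOn.comp (f := fun p : ℂ × E => p.2 + p.1 • u) (by fun_prop)
        fun p hp => hmem hp.2 (sphere_subset_closedBall hp.1)
    · exact (hf.comp (f := fun z => z + ζ • u) (by fun_prop)
        fun z hz => hmem hz (sphere_subset_closedBall hζ)).const_smul _
  have hball := ball_mem_nhds z₀ hρ
  refine ((hint.differentiableAt hball).congr_of_eventuallyEq ?_).differentiableWithinAt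
  filter_upwards [hball] with z hz
  exact fderiv_apply_eq_circleIntegral hr fun t ht =>
    hf.differentiableAt (hU.mem_nhds (hmem hz ht))

/-- The identity theorem, reduced to one variable by restriction to complex lines. -/
theorem eqOn_of_convex_of_eventuallyEq [CompleteSpace F] {f g : E → F} (hU : IsOpen U)
    (hconv : Convex ℝ U) (hf : DifferentiableOn ℂ f U) (hg : DifferentiableOn ℂ g U) {x : E}
    (hx : x ∈ U) (hfg : f =ᶠ[𝓝 x] g) : EqOn f g U := by
  intro y hy
  set line : ℂ → E := fun t => x + t • (y - x) with hline
  have hcont : Continuous line := by fun_prop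
  have hopen : IsOpen (line ⁻¹' U) := hU.preimage hcont
  have hline0 : line 0 = x := by simp [hline]
  have hline1 : line 1 = y := by simp [hline]
  have hanalytic {h : E → F} (hh : DifferentiableOn ℂ h U) :
      AnalyticOnNhd ℂ (h ∘ line) (line ⁻¹' U) :=
    (hh.comp (by unfold line; fun_prop) (mapsTo_preimage _ _)).analyticOnNhd hopen
  have hpre : IsPreconnected (line ⁻¹' U) :=
    ((hconv.translate_preimage_right x).linear_preimage
      ((LinearMap.toSpanSingleton ℂ E (y - x)).restrictScalars ℝ)).isPreconnected
  have heq := (hanalytic hf).eqOn_of_preconnected_of_eventuallyEq (hanalytic hg) hpre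
    (z₀ := 0) (by rwa [mem_preimage, hline0])
    ((hcont.tendsto' 0 x hline0).eventually hfg)
  simpa [hline1] using heq (x := 1) (by rwa [mem_preimage, hline1])

/-- Hartogs extension along the discs `y + (ζ - ℓ y) • e`, by the Cauchy integral over their
boundary circles. -/
theorem exists_differentiableOn_eqOn_of_circles [FiniteDimensional ℂ E] [CompleteSpace F]
    {f : E → F} {D D' T : Set E} (hD : IsOpen D) (hD' : D' ⊆ D) (e : E) (ℓ : E →L[ℂ] ℂ) {q : ℂ}
    {ρ : ℝ} (hρ : 0 < ρ) (hℓ : ∀ y ∈ D, ℓ y ∈ ball q ρ)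
    (hcircle : ∀ y ∈ D, ∀ ζ ∈ sphere q ρ, y + (ζ - ℓ y) • e ∈ T)
    (hdisc : ∀ y ∈ D', ∀ ζ ∈ closedBall q ρ, y + (ζ - ℓ y) • e ∈ T)
    (hf : DifferentiableOn ℂ f T) : ∃ g : E → F, DifferentiableOn ℂ g D ∧ EqOn g f D' := by
  refine ⟨fun y => (2 * Real.pi * Complex.I : ℂ)⁻¹ •
    ∮ ζ in C(q, ρ), (ζ - ℓ y)⁻¹ • f (y + (ζ - ℓ y) • e), ?_, fun y hy => ?_⟩
  · have hne {ζ : ℂ} {y : E} (hζ : ζ ∈ sphere q ρ) (hy : y ∈ D) : ζ - ℓ y ≠ 0 := by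
      rw [sub_ne_zero]
      rintro rfl
      exact (mem_ball.1 (hℓ y hy)).ne (mem_sphere.1 hζ)
    refine (differentiableOn_circleIntegral_of_param
      (G := fun ζ y => (ζ - ℓ y)⁻¹ • f (y + (ζ - ℓ y) • e)) hD hρ.le (.smul ?_ ?_)
      fun ζ hζ => .smul ?_ ?_).const_smul _
    · exact .inv₀ (by fun_prop) fun p hp => hne hp.1 hp.2
    · exact hf.continuousOn.comp (f := fun p : ℂ × E => p.2 + (p.1 - ℓ p.2) • e) (by fun_prop)
        fun p hp => hcircle p.2 hp.2 p.1 hp.1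
    · exact .inv (by fun_prop) fun y hy => hne hζ hy
    · exact hf.comp (f := fun y => y + (ζ - ℓ y) • e) (by fun_prop) fun y hy => hcircle y hy ζ hζ
  · have hcauchy := DifferentiableOn.circleIntegral_sub_inv_smul
      (hf.comp (f := fun ζ : ℂ => y + (ζ - ℓ y) • e) (by fun_prop) (hdisc y hy)) (hℓ y (hD' hy))
    simp only [Function.comp_def] at hcauchy
    simp only [hcauchy]
    rw [inv_smul_smul₀ Complex.two_pi_I_ne_zero, sub_self, zero_smul, add_zero]

end SeveralVariables

section ClosedDecompositions

open Set QuadraticMap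

variable {E : Type*} [NormedAddCommGroup E] [NormedSpace ℂ E]

theorem exists_eqOn_of_eqOn_inter {X Y ι : Type*} [Nonempty ι] {U : ι → Set X} {f : ι → X → Y}
    (h : ∀ i j, EqOn (f i) (f j) (U i ∩ U j)) : ∃ g : X → Y, ∀ i, EqOn g (f i) (U i) := by
  have hidx (x : X) : ∃ i, ∀ j, x ∈ U j → x ∈ U i := by
    by_cases hx : ∃ i, x ∈ U i
    · exact hx.imp fun i hi _ _ => hi
    · exact ⟨Classical.arbitrary ι, fun j hj => (hx ⟨j, hj⟩).elim⟩
  choose idx hidx using hidx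
  exact ⟨fun x => f (idx x) x, fun i x hx => h _ _ ⟨hidx x i hx, hx⟩⟩

/-- The 1-form `α` on `E` is holomorphic and closed at `y`. -/
structure IsClosedFormAt (α : E → E →L[ℂ] ℂ) (y : E) : Prop where
  differentiableAt : DifferentiableAt ℂ α y
  symm : ∀ u v, fderiv ℂ α y u v = fderiv ℂ α y v u

namespace IsClosedFormAt

variable {α β : E → E →L[ℂ] ℂ} {y : E}

theorem congr_of_eventuallyEq (hα : IsClosedFormAt α y) (h : β =ᶠ[𝓝 y] α) :
    IsClosedFormAt β y where
  differentiableAt := hα.differentiableAt.congr_of_eventuallyEq h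
  symm := by simpa only [h.fderiv_eq] using hα.symm

theorem differentiableAt_apply (hα : IsClosedFormAt α y) (v : E) :
    DifferentiableAt ℂ (fun z => α z v) y :=
  hα.differentiableAt.clm_apply (differentiableAt_const v)

theorem const_smul (hα : IsClosedFormAt α y) (c : ℂ) :
    IsClosedFormAt (fun z => c • α z) y where
  differentiableAt := hα.differentiableAt.const_smul c
  symm u v := by
    rw [fderiv_fun_const_smul hα.differentiableAt]
    simp [hα.symm u v]

theorem pullback {F : Type*} [NormedAddCommGroup F] [NormedSpace ℂ F] {φ : F → E} {z : F}
    (hα : IsClosedFormAt α (φ z)) (hφ : ContDiffAt ℂ ω φ z) :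
    IsClosedFormAt (fun z => (α (φ z)).comp (fderiv ℂ φ z)) z := by
  have hφ' : DifferentiableAt ℂ (fderiv ℂ φ) z :=
    (hφ.fderiv_right (m := 1) le_top).differentiableAt one_ne_zero
  have hcomp : HasFDerivAt (fun z => α (φ z)) ((fderiv ℂ α (φ z)).comp (fderiv ℂ φ z)) z :=
    hα.differentiableAt.hasFDerivAt.comp z (hφ.differentiableAt (by simp)).hasFDerivAt
  have hderiv := hcomp.clm_comp hφ'.hasFDerivAt
  refine ⟨hderiv.differentiableAt, fun u v => ?_⟩
  have hsymm : fderiv ℂ (fderiv ℂ φ) z u v = fderiv ℂ (fderiv ℂ φ) z v u :=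
    hφ.isSymmSndFDerivAt (by simp) u v
  simp [hderiv.fderiv, hsymm, hα.symm (fderiv ℂ φ z u)]

theorem fderiv_mul_apply_comm {f : E → ℂ} (hα : IsClosedFormAt α y) (hβ : IsClosedFormAt β y)
    (hf : DifferentiableAt ℂ f y) (h : β =ᶠ[𝓝 y] fun z => f z • α z) (u v : E) :
    fderiv ℂ f y u * α y v = fderiv ℂ f y v * α y u := by
  have hsymm := hβ.symm u v
  rw [h.fderiv_eq, fderiv_fun_smul hf hα.differentiableAt] at hsymm
  simpa [hα.symm u v] using hsymm

end IsClosedFormAt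

theorem linearIndependent_coe_iff {f g : E →L[ℂ] ℂ} :
    LinearIndependent ℂ ![(f : E →ₗ[ℂ] ℂ), g] ↔ LinearIndependent ℂ ![f, g] := by
  simp only [LinearIndependent.pair_iff]
  norm_cast

theorem eventually_linearIndependent_pair {𝕜 X G : Type*} [NontriviallyNormedField 𝕜]
    [CompleteSpace 𝕜] [TopologicalSpace X] [NormedAddCommGroup G] [NormedSpace 𝕜 G] {f g : X → G}
    {x : X} (hf : ContinuousAt f x) (hg : ContinuousAt g x)
    (h : LinearIndependent 𝕜 ![f x, g x]) : ∀ᶠ y in 𝓝 x, LinearIndependent 𝕜 ![f y, g y] := by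
  have hpair : ContinuousAt (fun y => ![f y, g y]) x :=
    continuousAt_pi.2 (Fin.forall_fin_two.2 ⟨hf, hg⟩)
  exact hpair.eventually h.eventually

theorem fderiv_eq_zero_of_decompositions {α β α' β' : E → E →L[ℂ] ℂ} {f : E → ℂ} {y : E}
    (hα : IsClosedFormAt α y) (hβ : IsClosedFormAt β y) (hα' : IsClosedFormAt α' y)
    (hβ' : IsClosedFormAt β' y) (hf : DifferentiableAt ℂ f y)
    (hαf : α =ᶠ[𝓝 y] fun z => f z • α' z) (hβf : β' =ᶠ[𝓝 y] fun z => f z • β z)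
    (hind : LinearIndependent ℂ ![α' y, β y]) : fderiv ℂ f y = 0 :=
  ContinuousLinearMap.coe_injective (eq_zero_of_mul_apply_comm
    (linearIndependent_coe_iff.2 hind) (hα'.fderiv_mul_apply_comm hα hf hαf)
    (hβ.fderiv_mul_apply_comm hβ' hf hβf))

/-- `W = α β` at `y`, where the 1-forms `α` and `β` are holomorphic and closed at `y`. -/
structure IsClosedDecompositionAt (W : E → QuadraticForm ℂ E) (α β : E → E →L[ℂ] ℂ) (y : E) :
    Prop where
  left : IsClosedFormAt α y
  right : IsClosedFormAt β y
  eq_linMulLin : W y = linMulLin (α y : E →ₗ[ℂ] ℂ) (β y : E →ₗ[ℂ] ℂ)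

namespace IsClosedDecompositionAt

variable {W : E → QuadraticForm ℂ E} {α β α' β' : E → E →L[ℂ] ℂ} {y : E}

theorem swap (h : IsClosedDecompositionAt W α β y) : IsClosedDecompositionAt W β α y :=
  ⟨h.right, h.left, h.eq_linMulLin.trans (linMulLin_comm _ _)⟩

theorem congr_of_eventuallyEq (h : IsClosedDecompositionAt W α β y) (hα : α' =ᶠ[𝓝 y] α)
    (hβ : β' =ᶠ[𝓝 y] β) : IsClosedDecompositionAt W α' β' y where
  left := h.left.congr_of_eventuallyEq hα
  right := h.right.congr_of_eventuallyEq hβ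
  eq_linMulLin := by rw [hα.eq_of_nhds, hβ.eq_of_nhds, h.eq_linMulLin]

theorem smul_inv_smul (h : IsClosedDecompositionAt W α β y) {c : ℂ} (hc : c ≠ 0) :
    IsClosedDecompositionAt W (fun z => c⁻¹ • α z) (fun z => c • β z) y where
  left := h.left.const_smul _
  right := h.right.const_smul _
  eq_linMulLin := by
    ext v
    simp only [h.eq_linMulLin, linMulLin_apply]
    simp [mul_mul_mul_comm, hc]

theorem linearIndependent (h : IsClosedDecompositionAt W α β y)
    (hW : DefinesTwoHyperplanes (W y)) : LinearIndependent ℂ ![α y, β y] :=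
  linearIndependent_coe_iff.1 (h.eq_linMulLin ▸ hW).linearIndependent

theorem exists_smul (h : IsClosedDecompositionAt W α β y) (h' : IsClosedDecompositionAt W α' β' y)
    (hind : LinearIndependent ℂ ![α y, β y]) :
    ∃ t : ℂ, t ≠ 0 ∧ ((α' y = t⁻¹ • α y ∧ β' y = t • β y) ∨
      (β' y = t⁻¹ • α y ∧ α' y = t • β y)) := by
  have hind' := linearIndependent_coe_iff.2 hind
  have hα : (α y : E →ₗ[ℂ] ℂ) ≠ 0 := hind'.ne_zero 0
  have hβ : (β y : E →ₗ[ℂ] ℂ) ≠ 0 := hind'.ne_zero 1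
  exact_mod_cast exists_smul_of_linMulLin_eq hα hβ (h'.eq_linMulLin.symm.trans h.eq_linMulLin)

theorem eventually_exists_smul {x : E} {t : ℂ} (h : ∀ᶠ y in 𝓝 x, IsClosedDecompositionAt W α β y)
    (h' : ∀ᶠ y in 𝓝 x, IsClosedDecompositionAt W α' β' y) (hind : LinearIndependent ℂ ![α x, β x])
    (ht : t ≠ 0) (hβ : β' x = t • β x) :
    ∀ᶠ y in 𝓝 x, ∃ s : ℂ, s ≠ 0 ∧ α' y = s⁻¹ • α y ∧ β' y = s • β y := by
  have hα := h.self_of_nhds.left.differentiableAt.continuousAt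
  have hind' : LinearIndependent ℂ ![α x, β' x] := by
    rw [hβ, ← one_smul ℂ (α x)]
    exact (LinearIndependent.pair_smul_smul_iff isUnit_one ht.isUnit).2 hind
  filter_upwards [h, h',
    eventually_linearIndependent_pair hα h.self_of_nhds.right.differentiableAt.continuousAt hind,
    eventually_linearIndependent_pair hα h'.self_of_nhds.right.differentiableAt.continuousAt hind']
    with y hy hy' hyi hyi'
  obtain ⟨s, hs, h | ⟨h, -⟩⟩ := hy.exists_smul hy' hyi
  · exact ⟨s, hs, h⟩
  · rw [h, LinearIndependent.pair_iff] at hyi'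
    exact absurd (hyi' s⁻¹ (-1) (by simp)).2 (by norm_num)

/-- The factor of proportionality between two closed decompositions is constant because all four
forms are closed. -/
theorem eq_of_eq_smul {B : Set E} {f : E → ℂ} (hB : IsOpen B) (hpre : IsPreconnected B)
    (h : ∀ y ∈ B, IsClosedDecompositionAt W α β y)
    (h' : ∀ y ∈ B, IsClosedDecompositionAt W α' β' y)
    (hind : ∀ y ∈ B, LinearIndependent ℂ ![α y, β y]) (hf : DifferentiableOn ℂ f B)
    (hratio : ∀ y ∈ B, f y ≠ 0 ∧ α' y = (f y)⁻¹ • α y ∧ β' y = f y • β y) {x z : E} (hx : x ∈ B)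
    (hz : z ∈ B) : f x = f z := by
  refine hB.is_const_of_fderiv_eq_zero hpre hf (fun y hy => ?_) hx hz
  have hnhds := hB.mem_nhds hy
  refine fderiv_eq_zero_of_decompositions (h y hy).left (h y hy).right (h' y hy).left
    (h' y hy).right (hf.differentiableAt hnhds) ?_ ?_ ?_
  · filter_upwards [hnhds] with z hz
    rw [(hratio z hz).2.1, smul_inv_smul₀ (hratio z hz).1]
  · filter_upwards [hnhds] with z hz using (hratio z hz).2.2
  · rw [(hratio y hy).2.1, ← one_smul ℂ (β y)]
    exact (LinearIndependent.pair_smul_smul_iff (inv_ne_zero (hratio y hy).1).isUnit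
      isUnit_one).2 (hind y hy)

theorem eventually_eq_smul {x : E} {t : ℂ} (h : ∀ᶠ y in 𝓝 x, IsClosedDecompositionAt W α β y)
    (h' : ∀ᶠ y in 𝓝 x, IsClosedDecompositionAt W α' β' y) (hind : LinearIndependent ℂ ![α x, β x])
    (ht : t ≠ 0) (hβ : β' x = t • β x) :
    ∀ᶠ y in 𝓝 x, α' y = t⁻¹ • α y ∧ β' y = t • β y := by
  obtain ⟨k, hk⟩ := DFunLike.ne_iff.1 (hind.ne_zero 1)
  have hβc := h.self_of_nhds.right.differentiableAt.continuousAt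
  have hβk : ∀ᶠ y in 𝓝 x, β y k ≠ 0 := (hβc.clm_apply continuousAt_const).eventually_ne hk
  have hindev : ∀ᶠ y in 𝓝 x, LinearIndependent ℂ ![α y, β y] :=
    eventually_linearIndependent_pair h.self_of_nhds.left.differentiableAt.continuousAt hβc hind
  obtain ⟨r, hr, hball⟩ := Metric.eventually_nhds_iff_ball.1
    (h.and (h'.and (hβk.and (hindev.and (eventually_exists_smul h h' hind ht hβ)))))
  set f : E → ℂ := fun y => β' y k * (β y k)⁻¹ with hf
  have hfd : DifferentiableOn ℂ f (Metric.ball x r) := fun y hy => by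
    have hnum : DifferentiableAt ℂ (fun z => β' z k) y :=
      (hball y hy).2.1.right.differentiableAt_apply k
    have hden : DifferentiableAt ℂ (fun z => β z k) y :=
      (hball y hy).1.right.differentiableAt_apply k
    exact (hnum.mul (hden.inv (hball y hy).2.2.1)).differentiableWithinAt
  have hratio (y : E) (hy : y ∈ Metric.ball x r) :
      f y ≠ 0 ∧ α' y = (f y)⁻¹ • α y ∧ β' y = f y • β y := by
    obtain ⟨-, -, hyk, -, s, hs, hαs, hβs⟩ := hball y hy
    have hfs : f y = s := by simp [hf, hβs, hyk]
    exact hfs ▸ ⟨hs, hαs, hβs⟩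
  have hfx : f x = t := by simp [hf, hβ, hβk.self_of_nhds]
  filter_upwards [Metric.ball_mem_nhds x hr] with y hy
  have hfy : f y = t := hfx ▸ eq_of_eq_smul Metric.isOpen_ball (convex_ball x r).isPreconnected
    (fun z hz => (hball z hz).1) (fun z hz => (hball z hz).2.1)
    (fun z hz => (hball z hz).2.2.2.1) hfd hratio hy (Metric.mem_ball_self hr)
  exact hfy ▸ (hratio y hy).2

end IsClosedDecompositionAt

/-- `W = α β` on `U` for some closed holomorphic 1-forms `α` and `β`. -/
def HasClosedDecompositionOn (W : E → QuadraticForm ℂ E) (U : Set E) : Prop :=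
  ∃ α β : E → E →L[ℂ] ℂ, ∀ y ∈ U, IsClosedDecompositionAt W α β y

namespace HasClosedDecompositionOn

variable {W : E → QuadraticForm ℂ E} {U V : Set E}

theorem mono (h : HasClosedDecompositionOn W V) (hUV : U ⊆ V) : HasClosedDecompositionOn W U :=
  h.imp fun _ => Exists.imp fun _ h y hy => h y (hUV hy)

theorem exists_eqOn {α β : E → E →L[ℂ] ℂ} {x : E} (hU : HasClosedDecompositionOn W U)
    (hV : ∀ y ∈ V, IsClosedDecompositionAt W α β y) (hUV : IsOpen (U ∩ V))
    (hconv : Convex ℝ (U ∩ V)) (hx : x ∈ U ∩ V) (hWx : DefinesTwoHyperplanes (W x)) :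
    ∃ α' β' : E → E →L[ℂ] ℂ, (∀ y ∈ U, IsClosedDecompositionAt W α' β' y) ∧
      EqOn α' α (U ∩ V) ∧ EqOn β' β (U ∩ V) := by
  obtain ⟨α₁, β₁, h⟩ := hU
  obtain ⟨t, ht, hor⟩ := (h x hx.1).exists_smul (hV x hx.2) ((h x hx.1).linearIndependent hWx)
  wlog hst : α x = t⁻¹ • α₁ x ∧ β x = t • β₁ x generalizing α₁ β₁ t
  · obtain ⟨hβ, hα⟩ := hor.resolve_left hst
    have hst' : α x = t⁻¹⁻¹ • β₁ x ∧ β x = t⁻¹ • α₁ x := ⟨by rw [hα, inv_inv], hβ⟩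
    exact this β₁ α₁ (fun y hy => (h y hy).swap) t⁻¹ (inv_ne_zero ht) (.inl hst') hst'
  have hnhds := hUV.mem_nhds hx
  have hev := IsClosedDecompositionAt.eventually_eq_smul
    (Filter.eventually_of_mem hnhds fun y hy => h y hy.1)
    (Filter.eventually_of_mem hnhds fun y hy => hV y hy.2)
    ((h x hx.1).linearIndependent hWx) ht hst.2
  have h' (y : E) (hy : y ∈ U) := (h y hy).smul_inv_smul ht
  exact ⟨_, _, h',
    eqOn_of_convex_of_eventuallyEq hUV hconv
      (fun y hy => (h' y hy.1).left.differentiableAt.differentiableWithinAt)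
      (fun y hy => (hV y hy.2).left.differentiableAt.differentiableWithinAt)
      hx (hev.mono fun _ h => h.1.symm),
    eqOn_of_convex_of_eventuallyEq hUV hconv
      (fun y hy => (h' y hy.1).right.differentiableAt.differentiableWithinAt)
      (fun y hy => (hV y hy.2).right.differentiableAt.differentiableWithinAt)
      hx (hev.mono fun _ h => h.2.symm)⟩

theorem iUnion {ι : Type*} {U : ι → Set E} (i₀ : ι) (hopen : ∀ i, IsOpen (U i))
    (hconv : ∀ i, Convex ℝ (U i)) (hne : ∀ i, (U i).Nonempty)
    (hbase : ∀ i j, (U i ∩ U j).Nonempty → (U i ∩ U j ∩ U i₀).Nonempty)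
    (hW : ⋃ i, U i ⊆ closure {y | DefinesTwoHyperplanes (W y)})
    (h : ∀ i, HasClosedDecompositionOn W (U i)) : HasClosedDecompositionOn W (⋃ i, U i) := by
  obtain ⟨α₀, β₀, h₀⟩ := h i₀
  have hnormal (i : ι) : ∃ α β : E → E →L[ℂ] ℂ, (∀ y ∈ U i, IsClosedDecompositionAt W α β y) ∧
      EqOn α α₀ (U i ∩ U i₀) ∧ EqOn β β₀ (U i ∩ U i₀) := by
    have hUV := (hopen i).inter (hopen i₀)
    obtain ⟨y, hy⟩ : (U i ∩ U i₀).Nonempty := by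
      simpa only [inter_self] using hbase i i (by simpa only [inter_self] using hne i)
    obtain ⟨x, hx, hWx⟩ := mem_closure_iff.1 (hW (mem_iUnion_of_mem i hy.1)) _ hUV hy
    exact (h i).exists_eqOn h₀ hUV ((hconv i).inter (hconv i₀)) hx hWx
  choose α β hαβ hα hβ using hnormal
  have hagree {γ : ι → E → E →L[ℂ] ℂ} {γ₀ : E → E →L[ℂ] ℂ}
      (hγ : ∀ i, EqOn (γ i) γ₀ (U i ∩ U i₀)) (hd : ∀ i, DifferentiableOn ℂ (γ i) (U i))
      (i j : ι) : EqOn (γ i) (γ j) (U i ∩ U j) := by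
    rcases (U i ∩ U j).eq_empty_or_nonempty with hij | hij
    · simp [hij]
    have hUV := (hopen i).inter (hopen j)
    obtain ⟨x, hx, hx₀⟩ := hbase i j hij
    refine eqOn_of_convex_of_eventuallyEq hUV ((hconv i).inter (hconv j))
      ((hd i).mono inter_subset_left) ((hd j).mono inter_subset_right) hx ?_
    filter_upwards [(hUV.inter (hopen i₀)).mem_nhds ⟨hx, hx₀⟩] with y hy
    rw [hγ i ⟨hy.1.1, hy.2⟩, hγ j ⟨hy.1.2, hy.2⟩]
  have : Nonempty ι := ⟨i₀⟩
  obtain ⟨A, hA⟩ := exists_eqOn_of_eqOn_inter (hagree hα fun i y hy =>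
    (hαβ i y hy).left.differentiableAt.differentiableWithinAt)
  obtain ⟨B, hB⟩ := exists_eqOn_of_eqOn_inter (hagree hβ fun i y hy =>
    (hαβ i y hy).right.differentiableAt.differentiableWithinAt)
  refine ⟨A, B, fun y hy => ?_⟩
  obtain ⟨i, hi⟩ := mem_iUnion.1 hy
  have hnhds := (hopen i).mem_nhds hi
  exact (hαβ i y hi).congr_of_eventuallyEq ((hA i).eventuallyEq_of_mem hnhds)
    ((hB i).eventuallyEq_of_mem hnhds)

theorem union (hUo : IsOpen U) (hVo : IsOpen V) (hUc : Convex ℝ U) (hVc : Convex ℝ V)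
    (hUV : (U ∩ V).Nonempty) (hW : U ∪ V ⊆ closure {y | DefinesTwoHyperplanes (W y)})
    (hU : HasClosedDecompositionOn W U) (hV : HasClosedDecompositionOn W V) :
    HasClosedDecompositionOn W (U ∪ V) := by
  rw [union_eq_iUnion] at hW ⊢
  refine iUnion true (by simp [*]) (by simp [*]) (by simp [hUV.left, hUV.right]) ?_ hW
    (by simp [*])
  obtain ⟨x, hxU, hxV⟩ := hUV
  rintro (_ | _) (_ | _) - <;> exact ⟨x, by simp [hxU, hxV]⟩

end HasClosedDecompositionOn

/-- `W` is a product of two closed holomorphic 1-forms near `x`. -/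
def HasClosedDecompositionAt (W : E → QuadraticForm ℂ E) (x : E) : Prop :=
  ∃ V ∈ 𝓝 x, HasClosedDecompositionOn W V

theorem exists_convex_isOpen_of_segment_subset {p x : E} {U : Set E} (hU : IsOpen U)
    (h : segment ℝ p x ⊆ U) : ∃ V ⊆ U, IsOpen V ∧ Convex ℝ V ∧ p ∈ V ∧ x ∈ V := by
  have hcompact : IsCompact (segment ℝ p x) := by
    rw [segment_eq_image_lineMap]
    exact isCompact_Icc.image AffineMap.lineMap_continuous
  obtain ⟨δ, hδ, hsub⟩ := hcompact.exists_thickening_subset_open hU h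
  have hseg := Metric.self_subset_thickening hδ (segment ℝ p x)
  exact ⟨_, hsub, Metric.isOpen_thickening, (convex_segment p x).thickening δ,
    hseg (left_mem_segment ℝ p x), hseg (right_mem_segment ℝ p x)⟩

/-- `W` has a closed decomposition on a convex open subset of `C` containing `p` and `x`. -/
def HasClosedDecompositionAlong (W : E → QuadraticForm ℂ E) (C : Set E) (p x : E) : Prop :=
  ∃ V ⊆ C, IsOpen V ∧ Convex ℝ V ∧ p ∈ V ∧ x ∈ V ∧ HasClosedDecompositionOn W V

section StarConvex

variable {W : E → QuadraticForm ℂ E} {C : Set E} {p x : E}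

theorem HasClosedDecompositionAt.exists_convex (h : HasClosedDecompositionAt W x) (hC : C ∈ 𝓝 x) :
    HasClosedDecompositionAlong W C x x := by
  obtain ⟨V, hV, hdec⟩ := h
  obtain ⟨r, hr, hball⟩ := Metric.mem_nhds_iff.1 (Filter.inter_mem hC hV)
  exact ⟨Metric.ball x r, fun _ hy => (hball hy).1, Metric.isOpen_ball, convex_ball x r,
    Metric.mem_ball_self hr, Metric.mem_ball_self hr, hdec.mono fun _ hy => (hball hy).2⟩

theorem HasClosedDecompositionAlong.trans {y : E} {s t : ℝ}
    (hW : C ⊆ closure {y | DefinesTwoHyperplanes (W y)})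
    (h₁ : HasClosedDecompositionAlong W C p (AffineMap.lineMap p y s))
    (h₂ : HasClosedDecompositionAlong W C (AffineMap.lineMap p y s) (AffineMap.lineMap p y t)) :
    HasClosedDecompositionAlong W C p (AffineMap.lineMap p y t) := by
  obtain ⟨V, hVC, hVo, hVc, hpV, hsV, hV⟩ := h₁
  obtain ⟨O, hOC, hOo, hOc, hsO, htO, hO⟩ := h₂
  have hline (a b : ℝ) : segment ℝ (AffineMap.lineMap p y a) (AffineMap.lineMap p y b) =
      AffineMap.lineMap p y '' uIcc a b := by
    rw [← image_segment, segment_eq_uIcc]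
  have hseg : segment ℝ p (AffineMap.lineMap p y t) ⊆ V ∪ O := by
    calc segment ℝ p (AffineMap.lineMap p y t)
        = segment ℝ (AffineMap.lineMap p y (0 : ℝ)) (AffineMap.lineMap p y t) := by
          rw [AffineMap.lineMap_apply_zero]
      _ ⊆ segment ℝ (AffineMap.lineMap p y (0 : ℝ)) (AffineMap.lineMap p y s) ∪
          segment ℝ (AffineMap.lineMap p y s) (AffineMap.lineMap p y t) := by
          simp only [hline, ← image_union]
          exact image_mono uIcc_subset_uIcc_union_uIcc
      _ ⊆ V ∪ O := union_subset_union
          (hVc.segment_subset (by rwa [AffineMap.lineMap_apply_zero]) hsV)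
          (hOc.segment_subset hsO htO)
  obtain ⟨T, hT, hTo, hTc, hpT, htT⟩ := exists_convex_isOpen_of_segment_subset (hVo.union hOo) hseg
  have hVOC : V ∪ O ⊆ C := union_subset hVC hOC
  exact ⟨T, hT.trans hVOC, hTo, hTc, hpT, htT,
    (hV.union hVo hOo hVc hOc ⟨_, hsV, hsO⟩ (hVOC.trans hW) hO).mono hT⟩

theorem hasClosedDecompositionAlong_of_segment_subset (hC : IsOpen C) (hseg : segment ℝ p x ⊆ C)
    (hloc : ∀ y ∈ C, HasClosedDecompositionAt W y)
    (hW : C ⊆ closure {y | DefinesTwoHyperplanes (W y)}) :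
    HasClosedDecompositionAlong W C p x := by
  set γ : ℝ →ᵃ[ℝ] E := AffineMap.lineMap p x
  have hγ : Continuous γ := AffineMap.lineMap_continuous
  have hγC (t : ℝ) (ht : t ∈ Icc 0 1) : γ t ∈ C :=
    hseg (by rw [segment_eq_image_lineMap]; exact mem_image_of_mem _ ht)
  set u : Set ℝ := {t | HasClosedDecompositionAlong W C p (γ t)}
  have hu : IsOpen u := isOpen_iff_mem_nhds.2 fun t ⟨V, hVC, hVo, hVc, hpV, htV, hV⟩ =>
    Filter.mem_of_superset ((hVo.preimage hγ).mem_nhds htV)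
      fun s hs => ⟨V, hVC, hVo, hVc, hpV, hs, hV⟩
  have hsub : Icc 0 1 ⊆ u := by
    refine isPreconnected_Icc.subset_of_closure_inter_subset hu
      ⟨0, left_mem_Icc.2 zero_le_one, ?_⟩ fun t ⟨ht, ht01⟩ => ?_
    · have hp := hγC 0 (left_mem_Icc.2 zero_le_one)
      simpa [u, γ] using (hloc _ hp).exists_convex (hC.mem_nhds hp)
    · obtain ⟨O, hOC, hOo, hOc, htO, -, hO⟩ :=
        (hloc _ (hγC t ht01)).exists_convex (hC.mem_nhds (hγC t ht01))
      obtain ⟨s, hsO, hs⟩ := mem_closure_iff.1 ht _ (hOo.preimage hγ) htO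
      exact hs.trans hW ⟨O, hOC, hOo, hOc, hsO, htO, hO⟩
  simpa [u, γ] using hsub (right_mem_Icc.2 zero_le_one)

theorem hasClosedDecompositionOn_of_starConvex (hstar : StarConvex ℝ p C) (hC : IsOpen C)
    (hp : p ∈ C) (hloc : ∀ y ∈ C, HasClosedDecompositionAt W y)
    (hW : C ⊆ closure {y | DefinesTwoHyperplanes (W y)}) : HasClosedDecompositionOn W C := by
  have htube (x : C) : HasClosedDecompositionAlong W C p x :=
    hasClosedDecompositionAlong_of_segment_subset hC (hstar.segment_subset x.2) hloc hW
  choose V hVC hVo hVc hpV hxV hV using htube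
  have hcover : ⋃ x, V x = C := (iUnion_subset hVC).antisymm
    fun x hx => mem_iUnion.2 ⟨⟨x, hx⟩, hxV _⟩
  rw [← hcover]
  exact .iUnion ⟨p, hp⟩ hVo hVc (fun x => ⟨p, hpV x⟩)
    (fun x y _ => ⟨p, ⟨hpV x, hpV y⟩, hpV _⟩) (hcover.symm ▸ hW) hV

end StarConvex

end ClosedDecompositions

section PuncturedBall

open Metric Set

variable {E : Type*} [NormedAddCommGroup E] [NormedSpace ℂ E]

theorem exists_dual_pair [FiniteDimensional ℂ E] (hE : 1 < Module.finrank ℂ E) :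
    ∃ (e₀ e₁ : E) (ℓ₀ ℓ₁ : E →L[ℂ] ℂ), ℓ₀ e₀ = 1 ∧ ℓ₀ e₁ = 0 ∧ ℓ₁ e₀ = 0 ∧ ℓ₁ e₁ = 1 := by
  set b := Module.finBasis ℂ E
  let i₀ : Fin (Module.finrank ℂ E) := ⟨0, by lia⟩
  let i₁ : Fin (Module.finrank ℂ E) := ⟨1, hE⟩
  exact ⟨b i₀, b i₁, (b.coord i₀).toContinuousLinearMap, (b.coord i₁).toContinuousLinearMap,
    by simp, by simp [i₀, i₁], by simp [i₀, i₁], by simp⟩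

/-- The ball slit along a real half-space of the complex hyperplane `ℓ₁ = ℓ₁ c`, whose edge
contains `c`. It is star-shaped, hence simply connected, and large enough for functions on it to
extend to `c`. -/
def slitBall (ℓ₀ ℓ₁ : E →L[ℂ] ℂ) (c : E) (r : ℝ) : Set E :=
  ball c r ∩ {y | ℓ₁ (y - c) ≠ 0 ∨ 0 < (ℓ₀ (y - c)).re}

variable {ℓ₀ ℓ₁ : E →L[ℂ] ℂ} {c : E} {r : ℝ}

theorem isOpen_slitBall : IsOpen (slitBall ℓ₀ ℓ₁ c r) := by
  have h₁ : IsOpen {y | ℓ₁ (y - c) ≠ 0} := isOpen_ne_fun (by fun_prop) continuous_const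
  have h₀ : IsOpen {y | 0 < (ℓ₀ (y - c)).re} := isOpen_lt continuous_const (by fun_prop)
  exact isOpen_ball.inter (h₁.union h₀)

theorem slitBall_subset : slitBall ℓ₀ ℓ₁ c r ⊆ ball c r \ {c} := by
  rintro y ⟨hy, hslit⟩
  refine ⟨hy, ?_⟩
  rintro rfl
  simp at hslit

theorem starConvex_slitBall {p : E} (hp : p ∈ ball c r) (hp₁ : ℓ₁ (p - c) = 0)
    (hp₀ : 0 < (ℓ₀ (p - c)).re) : StarConvex ℝ p (slitBall ℓ₀ ℓ₁ c r) := by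
  intro y hy a b ha hb hab
  refine ⟨convex_ball c r hp hy.1 ha hb hab, ?_⟩
  have hsplit : a • p + b • y - c = a • (p - c) + b • (y - c) := by
    rw [smul_sub, smul_sub, sub_add_sub_comm, ← add_smul, hab, one_smul]
  have hmap (ℓ : E →L[ℂ] ℂ) : ℓ (a • p + b • y - c) = a * ℓ (p - c) + b * ℓ (y - c) := by
    rw [hsplit, map_add, ℓ.map_smul_of_tower, ℓ.map_smul_of_tower]
    rfl
  simp only [mem_ofPred_eq, hmap, hp₁, mul_zero, zero_add, Complex.add_re, Complex.re_ofReal_mul]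
  rcases hb.eq_or_lt with rfl | hb
  · exact .inr (by simpa [show a = 1 by linarith] using hp₀)
  · exact hy.2.imp (mul_ne_zero (by exact_mod_cast hb.ne')) fun hy₀ => by positivity

theorem exists_extension_slitBall [FiniteDimensional ℂ E] {F : Type*} [NormedAddCommGroup F]
    [NormedSpace ℂ F] [CompleteSpace F] {e₁ : E} (h₀ : ℓ₀ e₁ = 0) (h₁ : ℓ₁ e₁ = 1) (hr : 0 < r) :
    ∃ D ⊆ ball c r, IsOpen D ∧ Convex ℝ D ∧ c ∈ D ∧
      ∀ f : E → F, DifferentiableOn ℂ f (slitBall ℓ₀ ℓ₁ c r) →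
        ∃ g : E → F, DifferentiableOn ℂ g D ∧ EqOn g f (D ∩ {y | 0 < (ℓ₀ (y - c)).re}) := by
  have he₁ : 0 < ‖e₁‖ := norm_pos_iff.2 fun h => by simp [h] at h₁
  set ρ := r / (4 * ‖e₁‖) with hρ_def
  have hρ : 0 < ρ := by positivity
  set D : Set E := ball c (r / 2) ∩ ℓ₁ ⁻¹' ball (ℓ₁ c) ρ
  have hball {y : E} (hy : y ∈ D) {ζ : ℂ} (hζ : ζ ∈ closedBall (ℓ₁ c) ρ) :
      y + (ζ - ℓ₁ y) • e₁ ∈ ball c r := by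
    have hζy : ‖ζ - ℓ₁ y‖ ≤ 2 * ρ := by
      rw [← dist_eq_norm]
      linarith [dist_triangle_right ζ (ℓ₁ y) (ℓ₁ c), mem_closedBall.1 hζ, mem_ball.1 hy.2]
    rw [mem_ball_iff_norm]
    calc ‖y + (ζ - ℓ₁ y) • e₁ - c‖ = ‖(y - c) + (ζ - ℓ₁ y) • e₁‖ := by rw [add_sub_right_comm]
      _ ≤ ‖y - c‖ + ‖ζ - ℓ₁ y‖ * ‖e₁‖ := (norm_add_le _ _).trans_eq (by rw [norm_smul])
      _ < r / 2 + 2 * ρ * ‖e₁‖ := add_lt_add_of_lt_of_le (mem_ball_iff_norm.1 hy.1) (by gcongr)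
      _ = r := by rw [hρ_def]; field_simp; norm_num
  have hℓ₁ (y : E) (ζ : ℂ) : ℓ₁ (y + (ζ - ℓ₁ y) • e₁ - c) = ζ - ℓ₁ c := by simp [h₁]
  have hℓ₀ (y : E) (ζ : ℂ) : ℓ₀ (y + (ζ - ℓ₁ y) • e₁ - c) = ℓ₀ (y - c) := by simp [h₀]
  have hD : IsOpen D := isOpen_ball.inter (isOpen_ball.preimage ℓ₁.continuous)
  refine ⟨D, inter_subset_left.trans (ball_subset_ball (by linarith)), hD,
    (convex_ball _ _).inter ((convex_ball _ _).linear_preimage (ℓ₁.toLinearMap.restrictScalars ℝ)),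
    ⟨mem_ball_self (by positivity), mem_ball_self hρ⟩, fun f hf => ?_⟩
  refine exists_differentiableOn_eqOn_of_circles (T := slitBall ℓ₀ ℓ₁ c r) hD inter_subset_left e₁
    ℓ₁ hρ (fun y hy => hy.2)
    (fun y hy ζ hζ => ⟨hball hy (sphere_subset_closedBall hζ), .inl ?_⟩)
    (fun y hy ζ hζ => ⟨hball hy.1 hζ, .inr ?_⟩) hf
  · rw [hℓ₁, sub_ne_zero]
    exact ne_of_mem_sphere hζ hρ.ne'
  · rw [hℓ₀]
    exact hy.2

theorem isClosedFormAt_of_eventually [FiniteDimensional ℂ E] {α : E → E →L[ℂ] ℂ} {D : Set E}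
    {p : E} (hD : IsOpen D) (hconv : Convex ℝ D) (hα : DifferentiableOn ℂ α D) (hp : p ∈ D)
    (h : ∀ᶠ y in 𝓝 p, IsClosedFormAt α y) {y : E} (hy : y ∈ D) : IsClosedFormAt α y := by
  have hderiv (u v : E) : DifferentiableOn ℂ (fun z => fderiv ℂ α z u v) D :=
    (differentiableOn_fderiv_apply hD hα u).clm_apply (differentiableOn_const v)
  exact ⟨hα.differentiableAt (hD.mem_nhds hy), fun u v =>
    eqOn_of_convex_of_eventuallyEq hD hconv (hderiv u v) (hderiv v u) hp
      (h.mono fun z hz => hz.symm u v) hy⟩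

theorem isClosedDecompositionAt_of_eventually [FiniteDimensional ℂ E] {W : E → QuadraticForm ℂ E}
    {α β : E → E →L[ℂ] ℂ} {D : Set E} {p : E} (hD : IsOpen D) (hconv : Convex ℝ D)
    (hW : ∀ v, DifferentiableOn ℂ (fun y => W y v) D) (hα : DifferentiableOn ℂ α D)
    (hβ : DifferentiableOn ℂ β D) (hp : p ∈ D)
    (h : ∀ᶠ y in 𝓝 p, IsClosedDecompositionAt W α β y) {y : E} (hy : y ∈ D) :
    IsClosedDecompositionAt W α β y where
  left := isClosedFormAt_of_eventually hD hconv hα hp (h.mono fun _ h => h.left) hy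
  right := isClosedFormAt_of_eventually hD hconv hβ hp (h.mono fun _ h => h.right) hy
  eq_linMulLin := QuadraticMap.ext fun v =>
    eqOn_of_convex_of_eventuallyEq hD hconv (hW v)
      ((hα.clm_apply (differentiableOn_const v)).mul (hβ.clm_apply (differentiableOn_const v))) hp
      (h.mono fun _ h => DFunLike.congr_fun h.eq_linMulLin v) hy

theorem hasClosedDecompositionAt_center [FiniteDimensional ℂ E] (hE : 1 < Module.finrank ℂ E)
    {W : E → QuadraticForm ℂ E} (hr : 0 < r)
    (hhol : ∀ v, DifferentiableOn ℂ (fun y => W y v) (ball c r))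
    (hW : ball c r ⊆ closure {y | DefinesTwoHyperplanes (W y)})
    (hloc : ∀ y ∈ ball c r \ {c}, HasClosedDecompositionAt W y) :
    HasClosedDecompositionAt W c := by
  obtain ⟨e₀, e₁, ℓ₀, ℓ₁, h₀₀, h₀₁, h₁₀, h₁₁⟩ := exists_dual_pair hE
  obtain ⟨D, hDball, hD, hconv, hcD, hext⟩ :=
    exists_extension_slitBall (F := E →L[ℂ] ℂ) (c := c) h₀₁ h₁₁ hr
  obtain ⟨t, htD, ht⟩ : ∃ t : ℝ, c + (t : ℂ) • e₀ ∈ D ∧ 0 < t := by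
    have hlim : Filter.Tendsto (fun t : ℝ => c + (t : ℂ) • e₀) (𝓝 0) (𝓝 c) :=
      Continuous.tendsto' (by fun_prop) _ _ (by simp)
    exact (((hlim.eventually (hD.mem_nhds hcD)).filter_mono nhdsWithin_le_nhds).and
      (self_mem_nhdsWithin (s := Ioi 0))).exists
  set p := c + (t : ℂ) • e₀
  have hp₀ : 0 < (ℓ₀ (p - c)).re := by simpa [p, h₀₀] using ht
  have hp₁ : ℓ₁ (p - c) = 0 := by simp [p, h₁₀]
  have hpT : p ∈ slitBall ℓ₀ ℓ₁ c r := ⟨hDball htD, .inr hp₀⟩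
  obtain ⟨α, β, hαβ⟩ := hasClosedDecompositionOn_of_starConvex
    (starConvex_slitBall (hDball htD) hp₁ hp₀) isOpen_slitBall hpT
    (fun y hy => hloc y (slitBall_subset hy))
    fun y hy => hW (slitBall_subset hy).1
  obtain ⟨α', hα', hαα'⟩ := hext α fun y hy =>
    (hαβ y hy).left.differentiableAt.differentiableWithinAt
  obtain ⟨β', hβ', hββ'⟩ := hext β fun y hy =>
    (hαβ y hy).right.differentiableAt.differentiableWithinAt
  have hD' : IsOpen (D ∩ {y | 0 < (ℓ₀ (y - c)).re}) :=
    hD.inter (isOpen_lt continuous_const (by fun_prop))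
  have hev : ∀ᶠ y in 𝓝 p, IsClosedDecompositionAt W α' β' y := by
    filter_upwards [hD'.mem_nhds ⟨htD, hp₀⟩] with y hy
    exact (hαβ y ⟨hDball hy.1, .inr hy.2⟩).congr_of_eventuallyEq
      (hαα'.eventuallyEq_of_mem (hD'.mem_nhds hy)) (hββ'.eventuallyEq_of_mem (hD'.mem_nhds hy))
  exact ⟨D, hD.mem_nhds hcD, α', β', fun y hy => isClosedDecompositionAt_of_eventually hD hconv
    (fun v => (hhol v).mono hDball) hα' hβ' htD hev hy⟩

end PuncturedBall

section Charts

variable {X : Type*} [TopologicalSpace X] [ChartedSpace C2 X]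

theorem mdifferentiable_of_mem_holomorphicCharts [IsManifold 𝓘(ℂ, C2) ω X]
    {e : OpenPartialHomeomorph X C2} (he : e ∈ holomorphicCharts X) :
    e.MDifferentiable 𝓘(ℂ, C2) 𝓘(ℂ, C2) :=
  ⟨(contMDiffOn_of_mem_maximalAtlas he).mdifferentiableOn (by simp),
    (contMDiffOn_symm_of_mem_maximalAtlas he).mdifferentiableOn (by simp)⟩

theorem OneFormField.IsClosedHolomorphicOn.isClosedFormAt_inChart {μ : OneFormField X} {U : Set X}
    (h : μ.IsClosedHolomorphicOn U) (hU : IsOpen U) {e : OpenPartialHomeomorph X C2}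
    (he : e ∈ holomorphicCharts X) {y : C2} (hy : y ∈ e.target ∩ e.symm ⁻¹' U) :
    IsClosedFormAt (μ.inChart e) y where
  differentiableAt :=
    (h.holomorphic e he).differentiableAt ((e.isOpen_inter_preimage_symm hU).mem_nhds hy)
  symm := h.closed e he y hy

/-- The pullback to `X` of the 1-form `α` under the chart `e`. -/
noncomputable def OneFormField.ofChart (e : OpenPartialHomeomorph X C2) (α : C2 → C2 →L[ℂ] ℂ) :
    OneFormField X :=
  fun x => (α (e x)).comp (mfderiv 𝓘(ℂ, C2) 𝓘(ℂ, C2) e x)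

theorem OneFormField.isClosedHolomorphicOn_ofChart [IsManifold 𝓘(ℂ, C2) ω X]
    {e : OpenPartialHomeomorph X C2} (he : e ∈ holomorphicCharts X) {α : C2 → C2 →L[ℂ] ℂ}
    {U : Set X} (hU : IsOpen U) (hUe : U ⊆ e.source) (hα : ∀ x ∈ U, IsClosedFormAt α (e x)) :
    (ofChart e α).IsClosedHolomorphicOn U := by
  have hclosed : ∀ e' ∈ holomorphicCharts X, ∀ y ∈ e'.target ∩ e'.symm ⁻¹' U,
      IsClosedFormAt ((ofChart e α).inChart e') y := by
    rintro e' he' y ⟨hy, hyU⟩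
    have hφ : ContDiffAt ℂ ω (e ∘ e'.symm) y :=
      contMDiffAt_iff_contDiffAt.1 ((contMDiffAt_of_mem_maximalAtlas he (hUe hyU)).comp y
        (contMDiffAt_symm_of_mem_maximalAtlas he' hy))
    refine (IsClosedFormAt.pullback (φ := e ∘ e'.symm) (hα _ hyU) hφ).congr_of_eventuallyEq ?_
    filter_upwards [(e'.isOpen_inter_preimage_symm hU).mem_nhds ⟨hy, hyU⟩] with z hz
    rw [← mfderiv_eq_fderiv, mfderiv_comp z
      ((mdifferentiable_of_mem_holomorphicCharts he).mdifferentiableAt (hUe hz.2))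
      ((mdifferentiable_of_mem_holomorphicCharts he').mdifferentiableAt_symm hz.1)]
    rfl
  exact ⟨fun e' he' y hy => (hclosed e' he' y hy).differentiableAt.differentiableWithinAt,
    fun e' he' y hy => (hclosed e' he' y hy).symm⟩

namespace SymmetricTwoDifferential

/-- The expression of `w` in the chart `e`: its pullback under `e.symm`. -/
noncomputable def inChart (w : SymmetricTwoDifferential X) (e : OpenPartialHomeomorph X C2)
    (y : C2) : QuadraticForm ℂ C2 :=
  (w.form (e.symm y)).comp (mfderiv 𝓘(ℂ, C2) 𝓘(ℂ, C2) e.symm y).toLinearMap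

variable {w : SymmetricTwoDifferential X} {e : OpenPartialHomeomorph X C2}

theorem HasHolomorphicClosedDecompositionAt.inChart (he : e ∈ holomorphicCharts X) {y : C2}
    (hy : y ∈ e.target) (h : w.HasHolomorphicClosedDecompositionAt (e.symm y)) :
    HasClosedDecompositionAt (w.inChart e) y := by
  obtain ⟨U, hU, hyU, μ₁, μ₂, h₁, h₂, hmul⟩ := h
  refine ⟨_, (e.isOpen_inter_preimage_symm hU).mem_nhds ⟨hy, hyU⟩, μ₁.inChart e, μ₂.inChart e,
    fun z hz => ⟨h₁.isClosedFormAt_inChart hU he hz, h₂.isClosedFormAt_inChart hU he hz, ?_⟩⟩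
  rw [SymmetricTwoDifferential.inChart, hmul _ hz.2]
  rfl

variable [IsManifold 𝓘(ℂ, C2) ω X]

theorem inChart_comp_mfderiv (he : e ∈ holomorphicCharts X) {x : X} (hx : x ∈ e.source) :
    (w.inChart e (e x)).comp (mfderiv 𝓘(ℂ, C2) 𝓘(ℂ, C2) e x).toLinearMap = w.form x := by
  have hinv := (mdifferentiable_of_mem_holomorphicCharts he).symm_comp_deriv hx
  have hform {x' : X} (hx' : x' = x) (M : C2 →ₗ[ℂ] C2) (hM : M = .id) :
      (w.form x').comp M = w.form x := by
    subst hx' hM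
    rfl
  exact hform (e.left_inv hx) _ (congrArg ContinuousLinearMap.toLinearMap hinv)

theorem hasHolomorphicClosedDecompositionAt_of_inChart (he : e ∈ holomorphicCharts X) {y : C2}
    (hy : y ∈ e.target) (h : HasClosedDecompositionAt (w.inChart e) y) :
    w.HasHolomorphicClosedDecompositionAt (e.symm y) := by
  obtain ⟨V, hV, α, β, hαβ⟩ := h
  obtain ⟨O, hOV, hO, hyO⟩ := mem_nhds_iff.1 hV
  have hU : IsOpen (e.source ∩ e ⁻¹' O) := e.isOpen_inter_preimage hO
  refine ⟨_, hU, ⟨e.map_target hy, by simpa [e.right_inv hy] using hyO⟩,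
    .ofChart e α, .ofChart e β,
    OneFormField.isClosedHolomorphicOn_ofChart he hU Set.inter_subset_left
      fun x hx => (hαβ _ (hOV hx.2)).left,
    OneFormField.isClosedHolomorphicOn_ofChart he hU Set.inter_subset_left
      fun x hx => (hαβ _ (hOV hx.2)).right,
    fun x hx => ?_⟩
  rw [← inChart_comp_mfderiv he hx.1, (hαβ _ (hOV hx.2)).eq_linMulLin]
  rfl

theorem HasRankTwo.target_subset_closure (hw : w.HasRankTwo) (he : e ∈ holomorphicCharts X) :
    e.target ⊆ closure {y | DefinesTwoHyperplanes (w.inChart e y)} := by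
  obtain ⟨U, -, hdense, hU⟩ := hw
  refine fun y hy => mem_closure_iff.2 fun V hV hyV => ?_
  obtain ⟨_, ⟨z, ⟨hzV, hz⟩, rfl⟩, hzU⟩ := hdense.inter_open_nonempty _
    (e.isOpen_image_symm_of_subset_target (hV.inter e.open_target) Set.inter_subset_right)
    (Set.Nonempty.image e.symm ⟨y, hyV, hy⟩)
  have htwo : DefinesTwoHyperplanes (w.form (e.symm z)) := hU _ hzU
  exact ⟨z, hzV, htwo.comp
    ((mdifferentiable_of_mem_holomorphicCharts he).symm.mfderiv_surjective hz)⟩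

theorem HasRankTwo.isOfFirstKindOn_ball (hw : w.HasRankTwo) (he : e ∈ holomorphicCharts X) {c : C2}
    {r : ℝ} (hball : Metric.ball c r ⊆ e.target)
    (h : w.IsOfFirstKindOn (e.symm '' (Metric.ball c r \ {c}))) :
    w.IsOfFirstKindOn (e.symm '' Metric.ball c r) := by
  rintro _ ⟨y, hy, rfl⟩
  obtain rfl | hyc := eq_or_ne y c
  · refine hasHolomorphicClosedDecompositionAt_of_inChart he (hball hy) ?_
    exact hasClosedDecompositionAt_center (by simp) (Metric.pos_of_mem_ball hy)
      (fun v => (w.holomorphic e he v).mono hball)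
      (hball.trans (hw.target_subset_closure he))
      fun x hx => (h _ ⟨x, hx, rfl⟩).inChart he (hball hx.1)
  · exact h _ ⟨y, ⟨hy, hyc⟩, rfl⟩

theorem HasRankTwo.preperfect_breakdownLocus (hw : w.HasRankTwo) :
    Preperfect w.breakdownLocus := by
  intro x hx
  by_contra hacc
  simp only [accPt_iff_nhds, not_forall, not_exists] at hacc
  obtain ⟨U, hU, hUx⟩ := hacc
  set e := chartAt C2 x
  have he : e ∈ holomorphicCharts X := IsManifold.chart_mem_maximalAtlas x
  have hxe : x ∈ e.source := mem_chart_source C2 x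
  obtain ⟨r, hr, hball⟩ := Metric.mem_nhds_iff.1 (Filter.inter_mem
    (e.open_target.mem_nhds (e.map_source hxe))
    ((e.continuousAt_symm (e.map_source hxe)).preimage_mem_nhds (by rwa [e.left_inv hxe])))
  have hfirst : w.IsOfFirstKindOn (e.symm '' (Metric.ball (e x) r \ {e x})) := by
    rintro _ ⟨y, ⟨hy, hyx⟩, rfl⟩
    by_contra hB
    refine hUx _ ⟨⟨(hball hy).2, hB⟩, fun h => hyx ?_⟩
    rw [Set.mem_singleton_iff, ← h, e.right_inv (hball hy).1]
  exact hx (hw.isOfFirstKindOn_ball he (fun y hy => (hball hy).1) hfirst x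
    ⟨e x, Metric.mem_ball_self hr, e.left_inv hxe⟩)

end SymmetricTwoDifferential

end Charts

theorem lemma2p2_general {X : Type*} [TopologicalSpace X] [ChartedSpace C2 X]
    [IsManifold 𝓘(ℂ, C2) ω X] (w : SymmetricTwoDifferential X) (hrank : w.HasRankTwo) :
    Preperfect w.breakdownLocus ∧
    (∀ e ∈ holomorphicCharts X, ∀ (c : C2) (r : ℝ), Metric.ball c r ⊆ e.target →
      w.IsOfFirstKindOn (e.symm '' (Metric.ball c r \ {c})) →
      w.IsOfFirstKindOn (e.symm '' Metric.ball c r)) :=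
  ⟨hrank.preperfect_breakdownLocus,
    fun _ he _ _ hball h => hrank.isOfFirstKindOn_ball he hball h⟩

/-- Let `w` be a symmetric 2-differential of rank 2 on a complex surface. If `w` is closed, its
breakdown locus has no isolated points (`Preperfect`: every point of the set is an accumulation
point of it). If `w` is of the 1st kind on a punctured coordinate ball, then it is of the 1st kind
on the whole ball. -/
theorem lemma2p2 {X : Type*} [TopologicalSpace X] [ChartedSpace C2 X]
    [IsManifold 𝓘(ℂ, C2) ω X] (w : SymmetricTwoDifferential X) (hrank : w.HasRankTwo) :
    (w.Closed → Preperfect w.breakdownLocus) ∧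
    (∀ e ∈ holomorphicCharts X, ∀ (c : C2) (r : ℝ), Metric.ball c r ⊆ e.target →
      w.IsOfFirstKindOn (e.symm '' (Metric.ball c r \ {c})) →
      w.IsOfFirstKindOn (e.symm '' Metric.ball c r)) :=
  ⟨fun _ => (lemma2p2_general w hrank).1, (lemma2p2_general w hrank).2⟩
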